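/- **Conventions.** For a cardinal $\kappa$ and a set $S$, $[S]^2$ is the set of unordered pairs of distinct elements of $S$ and $[S]^{\le\lambda}$ is the family of subsets of $S$ of cardinality at most $\lambda$. For sets of ordinals, $A<B$ means that $a<b$ for all $a\in A$, $b\in B$. If $X,Y$ are sets of ordinals of the same order type, $f_{YX}:X\to Y$ is the unique order-preserving bijection. We write $X=X_1*X_2$ if $X=X_1\cup X_2$, $X_1$ and $X_2$ have the same order type, and $X_1\cap X_2<X_1\setminus X_2<X_2\setminus X_1$. For a family $\mu$ of sets, $\mu|X=\{Y\in\mu: Y\subsetneq X\}$. A family of sets is directed if any two of its members are included in a third one. **2-cardinals.** Let $\kappa$ be a regular cardinal. A $(\kappa,\kappa^+)$-cardinal is a family $\mu$ of subsets of $\kappa^+$ of cardinality less than $\kappa$ such that 1. $\mu$ is well-founded with respect to inclusion (write $\mathrm{rank}(X)$ for the rank of $X\in\mu$); 2. $|\mu|X|<\kappa$ for all $X\in\mu$; 3. if $X,Y\in\mu$ and $\mathrm{rank}(X)=\mathrm{rank}(Y)$, then $X,Y$ have the same order type and $\mu|Y=\{f_{YX}[Z]: Z\in\mu|X\}$; 4.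 $\mu$ is directed; 5. for every $X\in\mu$, either $\mu|X$ is directed, or there are $X_1,X_2\in\mu$ of the same rank such that $X=X_1*X_2$ and $\mu|X=(\mu|X_1)\cup(\mu|X_2)\cup\{X_1,X_2\}$; 6. $\bigcup\mu=\kappa^+$; 7. $X=\bigcup(\mu|X)$ for every $X\in\mu$ of nonzero rank. The $\mu$-coloring is $m(\alpha,\beta)=\min\{\mathrm{rank}(X):\alpha,\beta\in X\in\mu\}$, and for $\alpha<\kappa^+$ the $\xi$-th term of the $\mu$-sequence at $\alpha$ is $\mu_\xi(\alpha)=X\cap\alpha$, where $X\in\mu$ is such that $\mathrm{rank}(X)=\xi$ and $\alpha\in X$ (this does not depend on the choice of $X$). **Collectionwise property $\Delta$.** A function $f:[\lambda^{++}]^2\to[\lambda^{++}]^{\le\lambda}$ has the collectionwise property $\Delta$ if for every family $(a_\xi)_{\xi<\lambda^+}$ of subsets of $\lambda^{++}$ of cardinalities less than $\lambda$ there is $A\subseteq\lambda^+$ of cardinality $\lambda^+$ such that for all distinct $\xi,\xi'\in A$ and all $\tau\in a_\xi\cap a_{\xi'}$, $\alpha\in a_\xi\setminus a_{\xi'}$,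 $\beta\in a_{\xi'}\setminus a_\xi$: 1. if $\tau<\alpha$ and $\tau<\beta$, then $\tau\in f(\alpha,\beta)$; 2. if $\tau<\beta$, then $f(\alpha,\tau)\subseteq f(\alpha,\beta)$; 3. if $\tau<\alpha$, then $f(\beta,\tau)\subseteq f(\alpha,\beta)$. **Theorem.** Let $\lambda$ be an infinite regular cardinal with $\lambda^{<\lambda}=\lambda$ and let $\mu$ be a $(\lambda^+,\lambda^{++})$-cardinal. Then there is a function $f:[\lambda^{++}]^2\to[\lambda^{++}]^{\le\lambda}$ with the collectionwise property $\Delta$. Moreover, $f$ can be taken to be the function given by $f(\alpha,\beta)=\mu_{m(\alpha,\beta)}(\alpha)$ for $\alpha<\beta<\lambda^{++}$, where $m$ is the $\mu$-coloring. -/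

import Mathlib

open Cardinal Order Set

universe u

noncomputable section

namespace TwoCardinal

/-- The set of all ordinals below the cardinal `κ`, as a well-ordered type of order type `κ.ord`.
Thus `Below (succ κ)` is the cardinal `κ⁺` viewed as a von Neumann ordinal. -/
abbrev Below (κ : Cardinal.{u}) : Type u := κ.ord.ToType

section Families

variable {W : Type u} [LinearOrder W]

/-- `μ|X`, the family of all members of `μ` that are proper subsets of `X`. -/
def restr (μ : Set (Set W)) (X : Set W) : Set (Set W) := {Y | Y ∈ μ ∧ Y ⊂ X}

/-- A family of sets is directed: any two members are included in a third one. -/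
def IsDirectedFamily (μ : Set (Set W)) : Prop :=
  ∀ X ∈ μ, ∀ Y ∈ μ, ∃ Z ∈ μ, X ⊆ Z ∧ Y ⊆ Z

/-- `A < B` for sets: every element of `A` lies below every element of `B`. -/
def SetLT (A B : Set W) : Prop := ∀ a ∈ A, ∀ b ∈ B, a < b

/-- `X = X₁ * X₂`: the sets `X₁`, `X₂` have the same order type,
`X₁ ∩ X₂ < X₁ \ X₂ < X₂ \ X₁`, and `X = X₁ ∪ X₂`. -/
def IsAmalgam (X X₁ X₂ : Set W) : Prop :=
  Nonempty (X₁ ≃o X₂) ∧ SetLT (X₁ ∩ X₂) (X₁ \ X₂) ∧ SetLT (X₁ \ X₂) (X₂ \ X₁) ∧ X = X₁ ∪ X₂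

/-- The image `e[Z] ⊆ Y` of `Z ⊆ X` under an order isomorphism `e : X ≃o Y`. -/
def transport {X Y : Set W} (e : X ≃o Y) (Z : Set W) : Set W :=
  {y | ∃ x : X, (x : W) ∈ Z ∧ (e x : W) = y}

/-- Proper inclusion between members of the family `μ`. -/
def properIncl (μ : Set (Set W)) (X Y : μ) : Prop := (X : Set W) ⊂ (Y : Set W)

/-- The rank of a member of a family that is well-founded with respect to inclusion. -/
def rank {μ : Set (Set W)} (wf : WellFounded (properIncl μ)) (X : μ) : Ordinal.{u} :=
  (wf.apply X).rank

end Families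

/-- `μ` is a `(κ, κ⁺)`-cardinal (neat simplified morass), for a regular cardinal `κ`. In
`homogeneous`, the order isomorphism between two well-ordered sets is unique. -/
structure IsTwoCardinal (κ : Cardinal.{u}) (μ : Set (Set (Below (succ κ)))) : Prop where
  small : ∀ X ∈ μ, #X < κ
  wellFounded : WellFounded (properIncl μ)
  locallySmall : ∀ X ∈ μ, #(restr μ X) < κ
  homogeneous : ∀ X Y : μ, rank wellFounded X = rank wellFounded Y →
    ∃ e : (X : Set (Below (succ κ))) ≃o (Y : Set (Below (succ κ))),
      restr μ Y = transport e '' restr μ X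
  directed : IsDirectedFamily μ
  locallyAlmostDirected : ∀ X : μ,
    IsDirectedFamily (restr μ X) ∨
    ∃ X₁ X₂ : μ, rank wellFounded X₁ = rank wellFounded X₂ ∧
      IsAmalgam (X : Set (Below (succ κ))) X₁ X₂ ∧
      restr μ X = restr μ X₁ ∪ restr μ X₂ ∪ {(X₁ : Set (Below (succ κ))), ↑X₂}
  covers : ⋃₀ μ = Set.univ
  neat : ∀ X : μ, rank wellFounded X ≠ 0 → (X : Set (Below (succ κ))) = ⋃₀ restr μ X

namespace IsTwoCardinal

variable {κ : Cardinal.{u}} {μ : Set (Set (Below (succ κ)))}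

/-- `S = μ_ξ(α)`, the `ξ`-th term of the `μ`-sequence at `α`: there is `X ∈ μ` of rank `ξ` such that
`α ∈ X` and `S = X ∩ α`, where `α` is identified with the set of smaller ordinals. -/
def IsTerm (h : IsTwoCardinal κ μ) (ξ : Ordinal.{u}) (α : Below (succ κ))
    (S : Set (Below (succ κ))) : Prop :=
  ∃ X : μ, rank h.wellFounded X = ξ ∧ α ∈ (X : Set (Below (succ κ))) ∧
    S = (X : Set (Below (succ κ))) ∩ Iio α

/-- The `μ`-coloring `m(α, β) = min {rank X : α, β ∈ X ∈ μ}`. -/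
def coloring (h : IsTwoCardinal κ μ) (α β : Below (succ κ)) : Ordinal.{u} :=
  sInf {ξ | ∃ X : μ, α ∈ (X : Set (Below (succ κ))) ∧ β ∈ (X : Set (Below (succ κ))) ∧
    rank h.wellFounded X = ξ}

/-- The minimum in the definition of the `μ`-coloring is attained. -/
theorem coloring_spec (h : IsTwoCardinal κ μ) (α β : Below (succ κ)) :
    ∃ X : μ, α ∈ (X : Set (Below (succ κ))) ∧ β ∈ (X : Set (Below (succ κ))) ∧
      rank h.wellFounded X = h.coloring α β := by
  have hne : {ξ | ∃ X : μ, α ∈ (X : Set (Below (succ κ))) ∧ β ∈ (X : Set (Below (succ κ))) ∧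
      rank h.wellFounded X = ξ}.Nonempty := by
    have hα : α ∈ ⋃₀ μ := by rw [h.covers]; trivial
    have hβ : β ∈ ⋃₀ μ := by rw [h.covers]; trivial
    obtain ⟨X, hX, hαX⟩ := hα
    obtain ⟨Y, hY, hβY⟩ := hβ
    obtain ⟨Z, hZ, hXZ, hYZ⟩ := h.directed X hX Y hY
    exact ⟨_, ⟨Z, hZ⟩, hXZ hαX, hYZ hβY, rfl⟩
  exact csInf_mem hne

end IsTwoCardinal

section PropertyDelta

variable {W : Type u} [LinearOrder W]

/-- The `Δ`-relations for the sets `a`, `a'`. Here `f : Sym2 W → Set W` represents a function on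
`[W]²`; only its values at unordered pairs of distinct points are used. -/
def DeltaRelations (f : Sym2 W → Set W) (a a' : Set W) : Prop :=
  ∀ τ ∈ a ∩ a', ∀ α ∈ a \ a', ∀ β ∈ a' \ a,
    (τ < α → τ < β → τ ∈ f s(α, β)) ∧
    (τ < β → f s(α, τ) ⊆ f s(α, β)) ∧
    (τ < α → f s(β, τ) ⊆ f s(α, β))

end PropertyDelta

/-- The collectionwise property `Δ` of `f : [lam⁺⁺]² → [lam⁺⁺]^{≤ lam}`: for every indexed family
of `lam⁺` subsets of `lam⁺⁺` of cardinalities `< lam`, there is a set of `lam⁺` many indices any two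
distinct elements of which satisfy the `Δ`-relations. -/
def CollectionwisePropertyDelta (lam : Cardinal.{u})
    (f : Sym2 (Below (succ (succ lam))) → Set (Below (succ (succ lam)))) : Prop :=
  ∀ a : Below (succ lam) → Set (Below (succ (succ lam))), (∀ ξ, #(a ξ) < lam) →
    ∃ A : Set (Below (succ lam)), #A = succ lam ∧
      ∀ ξ ∈ A, ∀ ξ' ∈ A, ξ ≠ ξ' → DeltaRelations f (a ξ) (a ξ')

end TwoCardinal

end

/-! Members of equal rank agree below every common element. Hence the term of rank `ξ` at `α` is `{x
< α | m(x, α) ≤ ξ}`, and `m` satisfies ultrametric inequalities (`coloring_le_max_of_le`). With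
these, the three `Δ`-relations reduce to the single inequality `m(α, τ) ≤ m(α, β)`, for `τ` in the
root and `α`, `β` in the two differences (`deltaRelations_of_coloring_le`).

To arrange this inequality, fix `γ` above all the sets, with `lam⁺` predecessors. If `ξ` has
cofinality at least `lam`, then for each `β ∈ a ξ` the interaction of `β` with the rank-`ξ` term at
`γ` is governed by some `η < ξ` (`exists_lt_forall_coloring_le`). As `a ξ` has fewer than `lam`
elements, one `η < ξ` serves them all, and pressing down gives one `η` for unboundedly many `ξ`. The
points `x < γ` with `m(x, γ) ≤ η` number at most `lam`, so `lam^{<lam} = lam` lets the trace of `a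
ξ` on them be fixed as well. Thinning out so that earlier sets have colors with `γ` below later
indices, `coloring_le_coloring_of_root` applies. -/

namespace TwoCardinal

/-! ### Ranks, and transport along order isomorphisms. -/

section Rank

variable {W : Type u} {μ : Set (Set W)} (wf : WellFounded (properIncl μ))

theorem rank_lt_rank {X Y : μ} (h : (X : Set W) ⊂ Y) : rank wf X < rank wf Y :=
  Acc.rank_lt_of_rel (wf.apply Y) h

theorem rank_le_rank {X Y : μ} (h : (X : Set W) ⊆ Y) : rank wf X ≤ rank wf Y := by
  rcases h.eq_or_ssubset with h | h
  · rw [Subtype.ext h]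
  · exact (rank_lt_rank wf h).le

theorem exists_le_rank_of_lt {X : μ} {o : Ordinal.{u}} (h : o < rank wf X) :
    ∃ Y : μ, (Y : Set W) ⊂ X ∧ o ≤ rank wf Y := by
  rw [rank, Acc.rank_eq, Ordinal.lt_iSup_iff] at h
  obtain ⟨⟨Y, hY⟩, h⟩ := h
  exact ⟨Y, hY, Order.lt_succ_iff.1 h⟩

end Rank

section Transport

variable {W : Type u} [LinearOrder W]

theorem mem_transport {X Y : Set W} (e : X ≃o Y) {Z : Set W} {x : W} (hx : x ∈ X) (hZ : x ∈ Z) :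
    (e ⟨x, hx⟩ : W) ∈ transport e Z :=
  ⟨⟨x, hx⟩, hZ, rfl⟩

theorem transport_mono {X Y : Set W} (e : X ≃o Y) {Z Z' : Set W} (h : Z ⊆ Z') :
    transport e Z ⊆ transport e Z' := by
  rintro _ ⟨x, hx, rfl⟩
  exact ⟨x, h hx, rfl⟩

theorem transport_subset_transport_iff {X Y : Set W} (e : X ≃o Y) {Z Z' : Set W} (hZ : Z ⊆ X) :
    transport e Z ⊆ transport e Z' ↔ Z ⊆ Z' := by
  refine ⟨fun h x hx => ?_, transport_mono e⟩
  obtain ⟨y, hy, hxy⟩ := h (mem_transport e (hZ hx) hx)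
  rwa [e.injective (Subtype.ext hxy)] at hy

theorem transport_ssubset_transport_iff {X Y : Set W} (e : X ≃o Y) {Z Z' : Set W} (hZ : Z ⊆ X)
    (hZ' : Z' ⊆ X) : transport e Z ⊂ transport e Z' ↔ Z ⊂ Z' := by
  rw [ssubset_iff_subset_not_subset, ssubset_iff_subset_not_subset,
    transport_subset_transport_iff e hZ, transport_subset_transport_iff e hZ']

/-- An order isomorphism between two sets that agree below a common element fixes that element. -/
theorem orderIso_apply_eq_self [WellFoundedLT W] {X Y : Set W} (e : X ≃o Y) (α : W) (hX : α ∈ X)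
    (hY : α ∈ Y) (h : ∀ β < α, β ∈ X ↔ β ∈ Y) : (e ⟨α, hX⟩ : W) = α := by
  induction α using WellFoundedLT.induction with
  | ind α ih =>
    have ih' : ∀ β (hβ : β < α) (hβX : β ∈ X), (e ⟨β, hβX⟩ : W) = β := fun β hβ hβX =>
      ih β hβ hβX ((h β hβ).1 hβX) fun δ hδ => h δ (hδ.trans hβ)
    rcases lt_trichotomy (e ⟨α, hX⟩ : W) α with hlt | heq | hgt
    · have hmem := (h _ hlt).2 (e ⟨α, hX⟩).2
      have := e.injective (Subtype.ext (ih' _ hlt hmem))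
      exact congrArg Subtype.val this
    · exact heq
    · have hlt : e.symm ⟨α, hY⟩ < ⟨α, hX⟩ := by
        rw [OrderIso.symm_apply_lt]
        exact hgt
      have := ih' _ hlt (e.symm ⟨α, hY⟩).2
      simp only [Subtype.coe_eta, OrderIso.apply_symm_apply] at this
      exact absurd hlt (by rw [← Subtype.coe_lt_coe, ← this]; exact lt_irrefl _)

end Transport

/-! ### Coherence of the members of a 2-cardinal. -/

namespace IsTwoCardinal

variable {κ : Cardinal.{u}} {μ : Set (Set (Below (succ κ)))} (h : IsTwoCardinal κ μ)

include h

/-- The isomorphism between two members of the same rank preserves the members below them and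
their ranks. -/
theorem exists_orderIso {X Y : μ} (hXY : rank h.wellFounded X = rank h.wellFounded Y) :
    ∃ e : (X : Set (Below (succ κ))) ≃o (Y : Set (Below (succ κ))),
      ∀ Z : μ, (Z : Set (Below (succ κ))) ⊆ X → ∃ Z' : μ, (Z' : Set (Below (succ κ))) ⊆ Y ∧
        (Z' : Set (Below (succ κ))) = transport e Z ∧
        rank h.wellFounded Z' = rank h.wellFounded Z := by
  obtain ⟨e, he⟩ := h.homogeneous X Y hXY
  refine ⟨e, fun Z => ?_⟩
  induction Z using h.wellFounded.induction with
  | _ Z ih =>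
    intro hZ
    rcases hZ.eq_or_ssubset with hZ | hZ
    · refine ⟨Y, subset_rfl, ?_, ?_⟩
      · ext y
        refine ⟨fun hy => ⟨e.symm ⟨y, hy⟩, ?_, by simp⟩, ?_⟩
        · rw [hZ]
          exact (e.symm ⟨y, hy⟩).2
        · rintro ⟨x, -, rfl⟩
          exact (e x).2
      · rw [← hXY, Subtype.ext hZ]
    · have hmem : transport e Z ∈ restr μ Y := by
        rw [he]
        exact ⟨Z, ⟨Z.2, hZ⟩, rfl⟩
      refine ⟨⟨_, hmem.1⟩, hmem.2.subset, rfl, le_antisymm ?_ ?_⟩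
      · refine le_of_forall_lt fun o ho => ?_
        obtain ⟨Q, hQ, hoQ⟩ := exists_le_rank_of_lt _ ho
        have hQ' : (Q : Set (Below (succ κ))) ∈ restr μ Y := ⟨Q.2, hQ.trans hmem.2⟩
        rw [he] at hQ'
        -- By homogeneity, everything properly inside the image of `Z` is itself the image of a
        -- member inside `Z`, so the induction hypothesis bounds its rank.
        obtain ⟨V, hV, hVQ⟩ := hQ'
        have hVZ : V ⊂ Z := by
          rw [← transport_ssubset_transport_iff e hV.2.subset hZ.subset, hVQ]
          exact hQ
        obtain ⟨V', -, hV', hr⟩ := ih ⟨V, hV.1⟩ hVZ hV.2.subset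
        rw [show V' = Q from Subtype.ext (hV'.trans hVQ)] at hr
        exact hoQ.trans_lt (hr.trans_lt (rank_lt_rank _ hVZ))
      · refine le_of_forall_lt fun o ho => ?_
        obtain ⟨V, hV, hoV⟩ := exists_le_rank_of_lt _ ho
        obtain ⟨V', -, hV', hr⟩ := ih V hV (hV.subset.trans hZ.subset)
        refine (hoV.trans hr.ge).trans_lt (rank_lt_rank _ ?_)
        rw [hV']
        exact (transport_ssubset_transport_iff e (hV.subset.trans hZ.subset) hZ.subset).2 hV

theorem exists_superset (X Y : μ) : ∃ Z : μ, (X : Set (Below (succ κ))) ⊆ Z ∧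
    (Y : Set (Below (succ κ))) ⊆ Z := by
  obtain ⟨Z, hZ, h1, h2⟩ := h.directed X X.2 Y Y.2
  exact ⟨⟨Z, hZ⟩, h1, h2⟩

/-- In an amalgam, the intersection of the two halves is an initial segment of both. -/
theorem initial_of_isAmalgam {X X₁ X₂ : μ}
    (hr : rank h.wellFounded X₁ = rank h.wellFounded X₂)
    (ha : IsAmalgam (X : Set (Below (succ κ))) X₁ X₂) {α β : Below (succ κ)}
    (h1 : α ∈ (X₁ : Set (Below (succ κ)))) (h2 : α ∈ (X₂ : Set (Below (succ κ)))) (hβ : β < α) :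
    β ∈ (X₁ : Set (Below (succ κ))) ↔ β ∈ (X₂ : Set (Below (succ κ))) := by
  obtain ⟨-, hl1, hl2, -⟩ := ha
  constructor
  · intro hb
    by_contra hb'
    exact (hl1 α ⟨h1, h2⟩ β ⟨hb, hb'⟩).not_gt hβ
  · intro hb
    by_contra hb'
    -- Otherwise `X₁` would be properly included in `X₂`, contradicting the equality of ranks.
    obtain ⟨δ, hδ⟩ : ((X₁ : Set (Below (succ κ))) \ X₂).Nonempty := by
      rw [nonempty_iff_ne_empty, Ne, sdiff_eq_empty]
      intro hs
      refine (rank_lt_rank h.wellFounded (hs.ssubset_of_ne fun he => ?_)).ne hr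
      exact hb' (he ▸ hb)
    exact ((hl1 α ⟨h1, h2⟩ δ hδ).trans (hl2 δ hδ β ⟨hb, hb'⟩)).not_gt hβ

/-- Members of the same rank cohere below their common elements. -/
theorem mem_of_rank_eq {X Y : μ} (hXY : rank h.wellFounded X = rank h.wellFounded Y)
    {α β : Below (succ κ)} (hαX : α ∈ (X : Set (Below (succ κ))))
    (hαY : α ∈ (Y : Set (Below (succ κ)))) (hβ : β < α) (hβX : β ∈ (X : Set (Below (succ κ)))) :
    β ∈ (Y : Set (Below (succ κ))) := by
  obtain ⟨Z, hXZ, hYZ⟩ := h.exists_superset X Y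
  induction Z using h.wellFounded.induction generalizing X Y with
  | _ Z ih =>
    rcases hXZ.eq_or_ssubset with hX | hX
    · rcases hYZ.eq_or_ssubset with hY | hY
      · rw [hY, ← hX]
        exact hβX
      · exact absurd (rank_lt_rank h.wellFounded (hY.trans_eq hX.symm)) hXY.not_gt
    rcases hYZ.eq_or_ssubset with hY | hY
    · exact absurd (rank_lt_rank h.wellFounded (hX.trans_eq hY.symm)) hXY.not_lt
    rcases h.locallyAlmostDirected Z with hd | ⟨Z₁, Z₂, hr, ha, hcup⟩
    · obtain ⟨V, hV, hXV, hYV⟩ := hd X ⟨X.2, hX⟩ Y ⟨Y.2, hY⟩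
      exact ih ⟨V, hV.1⟩ hV.2 hXY hαX hαY hβX hXV hYV
    have hsub : ∀ V : μ, (V : Set (Below (succ κ))) ⊂ Z →
        (V : Set (Below (succ κ))) ⊆ Z₁ ∨ (V : Set (Below (succ κ))) ⊆ Z₂ := by
      intro V hV
      have : (V : Set (Below (succ κ))) ∈ restr μ Z := ⟨V.2, hV⟩
      rw [hcup] at this
      rcases this with (hV | hV) | hV | hV
      · exact Or.inl hV.2.subset
      · exact Or.inr hV.2.subset
      · exact Or.inl hV.subset
      · exact Or.inr (mem_singleton_iff.1 hV).subset
    have hZ₁ : (Z₁ : Set (Below (succ κ))) ⊂ Z := by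
      have : (Z₁ : Set (Below (succ κ))) ∈ restr μ Z := by rw [hcup]; simp
      exact this.2
    have hZ₂ : (Z₂ : Set (Below (succ κ))) ⊂ Z := by
      have : (Z₂ : Set (Below (succ κ))) ∈ restr μ Z := by rw [hcup]; simp
      exact this.2
    -- When `X` and `Y` lie in different halves, the isomorphism between the halves moves `X` next
    -- to `Y`. It fixes `α` and `β`, since the halves agree up to `α`, so induction applies inside
    -- one half.
    have key : ∀ Z₁ Z₂ : μ, rank h.wellFounded Z₁ = rank h.wellFounded Z₂ →
        (∀ δ, δ ∈ (Z₁ : Set (Below (succ κ))) → δ ∈ (Z₂ : Set (Below (succ κ))) → ∀ ε < δ,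
          (ε ∈ (Z₁ : Set (Below (succ κ))) ↔ ε ∈ (Z₂ : Set (Below (succ κ))))) →
        (Z₂ : Set (Below (succ κ))) ⊂ Z →
        (X : Set (Below (succ κ))) ⊆ Z₁ → (Y : Set (Below (succ κ))) ⊆ Z₂ →
        β ∈ (Y : Set (Below (succ κ))) := by
      intro Z₁ Z₂ hr hi hZ₂ hX₁ hY₂
      obtain ⟨e, he⟩ := h.exists_orderIso hr
      obtain ⟨X', hX'Z, hX', hrX'⟩ := he X hX₁
      have hα := hi α (hX₁ hαX) (hY₂ hαY)
      have eα : (e ⟨α, hX₁ hαX⟩ : Below (succ κ)) = α :=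
        orderIso_apply_eq_self e α _ (hY₂ hαY) hα
      have eβ : (e ⟨β, hX₁ hβX⟩ : Below (succ κ)) = β :=
        orderIso_apply_eq_self e β _ ((hα β hβ).1 (hX₁ hβX)) fun δ hδ => hα δ (hδ.trans hβ)
      have hαX' : α ∈ (X' : Set (Below (succ κ))) := by
        rw [hX', ← eα]
        exact mem_transport e _ hαX
      have hβX' : β ∈ (X' : Set (Below (succ κ))) := by
        rw [hX', ← eβ]
        exact mem_transport e _ hβX
      exact ih Z₂ hZ₂ (hrX'.trans hXY) hαX' hαY hβX' hX'Z hY₂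
    rcases hsub X hX with hX₁ | hX₂ <;> rcases hsub Y hY with hY₁ | hY₂
    · exact ih Z₁ hZ₁ hXY hαX hαY hβX hX₁ hY₁
    · exact key Z₁ Z₂ hr (fun δ h1 h2 ε hε => h.initial_of_isAmalgam hr ha h1 h2 hε) hZ₂ hX₁ hY₂
    · exact key Z₂ Z₁ hr.symm (fun δ h2 h1 ε hε => (h.initial_of_isAmalgam hr ha h1 h2 hε).symm)
        hZ₁ hX₂ hY₁
    · exact ih Z₂ hZ₂ hXY hαX hαY hβX hX₂ hY₂

/-- Descending through proper members containing `α` never skips past `ξ`. In the directed case a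
member around `α` is merged with one of rank at least `ξ`; in the amalgam case both halves have rank
at least `ξ`, and one contains `α`. -/
theorem exists_subset_rank_eq {X : μ} {α : Below (succ κ)} (hα : α ∈ (X : Set (Below (succ κ))))
    {ξ : Ordinal.{u}} (hξ : ξ ≤ rank h.wellFounded X) :
    ∃ Y : μ, (Y : Set (Below (succ κ))) ⊆ X ∧ α ∈ (Y : Set (Below (succ κ))) ∧
      rank h.wellFounded Y = ξ := by
  induction X using h.wellFounded.induction with
  | _ X ih =>
    rcases hξ.eq_or_lt with hξ | hξ
    · exact ⟨X, subset_rfl, hα, hξ.symm⟩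
    suffices ∃ V : μ, (V : Set (Below (succ κ))) ⊂ X ∧ α ∈ (V : Set (Below (succ κ))) ∧
        ξ ≤ rank h.wellFounded V by
      obtain ⟨V, hV, hαV, hξV⟩ := this
      obtain ⟨Y, hY, hαY, hr⟩ := ih V hV hαV hξV
      exact ⟨Y, hY.trans hV.subset, hαY, hr⟩
    obtain ⟨Y, hY, hξY⟩ := exists_le_rank_of_lt _ hξ
    have hα' := hα
    rw [h.neat X ((zero_le).trans_lt hξ).ne'] at hα'
    obtain ⟨V, hV, hαV⟩ := hα'
    rcases h.locallyAlmostDirected X with hd | ⟨X₁, X₂, hr, ha, hcup⟩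
    · obtain ⟨U, hU, hYU, hVU⟩ := hd Y ⟨Y.2, hY⟩ V hV
      exact ⟨⟨U, hU.1⟩, hU.2, hVU hαV, hξY.trans (rank_le_rank h.wellFounded hYU)⟩
    · have hX₁ : (X₁ : Set (Below (succ κ))) ∈ restr μ X := by rw [hcup]; simp
      have hX₂ : (X₂ : Set (Below (succ κ))) ∈ restr μ X := by rw [hcup]; simp
      have hξ₁ : ξ ≤ rank h.wellFounded X₁ := by
        have : (Y : Set (Below (succ κ))) ∈ restr μ X := ⟨Y.2, hY⟩
        rw [hcup] at this
        rcases this with (hV | hV) | hV | hV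
        · exact hξY.trans (rank_le_rank h.wellFounded hV.2.subset)
        · exact hξY.trans ((rank_le_rank h.wellFounded hV.2.subset).trans hr.ge)
        · exact hξY.trans (rank_le_rank h.wellFounded hV.subset)
        · exact hξY.trans ((rank_le_rank h.wellFounded (mem_singleton_iff.1 hV).subset).trans hr.ge)
      rw [ha.2.2.2] at hα
      rcases hα with hα | hα
      · exact ⟨X₁, hX₁.2, hα, hξ₁⟩
      · exact ⟨X₂, hX₂.2, hα, hξ₁.trans hr.le⟩

theorem mem_of_rank_le {X Y : μ} (hXY : rank h.wellFounded X ≤ rank h.wellFounded Y)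
    {α β : Below (succ κ)} (hαX : α ∈ (X : Set (Below (succ κ))))
    (hαY : α ∈ (Y : Set (Below (succ κ)))) (hβ : β ≤ α) (hβX : β ∈ (X : Set (Below (succ κ)))) :
    β ∈ (Y : Set (Below (succ κ))) := by
  rcases hβ.eq_or_lt with rfl | hβ
  · exact hαY
  obtain ⟨V, hV, hαV, hr⟩ := h.exists_subset_rank_eq hαY hXY
  exact hV (h.mem_of_rank_eq hr.symm hαX hαV hβ hβX)

/-! ### Ultrametric properties of the coloring. -/

theorem coloring_le {X : μ} {α β : Below (succ κ)} (hα : α ∈ (X : Set (Below (succ κ))))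
    (hβ : β ∈ (X : Set (Below (succ κ)))) : h.coloring α β ≤ rank h.wellFounded X :=
  csInf_le' ⟨X, hα, hβ, rfl⟩

theorem coloring_comm (α β : Below (succ κ)) : h.coloring α β = h.coloring β α := by
  simp only [coloring, and_left_comm]

theorem mem_of_coloring_le {X : μ} {α β : Below (succ κ)} (hα : α ∈ (X : Set (Below (succ κ))))
    (hβ : β ≤ α) (hm : h.coloring β α ≤ rank h.wellFounded X) :
    β ∈ (X : Set (Below (succ κ))) := by
  obtain ⟨V, hβV, hαV, hr⟩ := h.coloring_spec β α
  exact h.mem_of_rank_le (hr.trans_le hm) hαV hα hβ hβV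

theorem exists_mem_rank_eq (α : Below (succ κ)) {X : μ} {ξ : Ordinal.{u}}
    (hξ : ξ ≤ rank h.wellFounded X) :
    ∃ Y : μ, α ∈ (Y : Set (Below (succ κ))) ∧ rank h.wellFounded Y = ξ := by
  obtain ⟨V, hV, -, -⟩ := h.coloring_spec α α
  obtain ⟨Z, hXZ, hVZ⟩ := h.exists_superset X V
  obtain ⟨Y, -, hY⟩ := h.exists_subset_rank_eq (hVZ hV)
    (hξ.trans (rank_le_rank h.wellFounded hXZ))
  exact ⟨Y, hY⟩

theorem coloring_le_max_of_le {x y z : Below (succ κ)} (hxz : x ≤ z) :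
    h.coloring x y ≤ max (h.coloring x z) (h.coloring y z) := by
  obtain ⟨X, hxX, hzX, hX⟩ := h.coloring_spec x z
  obtain ⟨Y, hyY, hzY, hY⟩ := h.coloring_spec y z
  rw [← hX, ← hY]
  rcases le_total (rank h.wellFounded X) (rank h.wellFounded Y) with hr | hr
  · exact (h.coloring_le (h.mem_of_rank_le hr hzX hzY hxz hxX) hyY).trans (le_max_right _ _)
  rcases le_total y z with hyz | hyz
  · exact (h.coloring_le hxX (h.mem_of_rank_le hr hzY hzX hyz hyY)).trans (le_max_left _ _)
  -- For `z ≤ y`, a member through `y` of the same rank as `X` picks up `z` from `Y`, and then `x`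
  -- from `X`.
  · obtain ⟨V, hyV, hV⟩ := h.exists_mem_rank_eq y le_rfl (X := X)
    have hzV := h.mem_of_rank_le (hr.trans hV.ge) hyY hyV hyz hzY
    exact ((h.coloring_le (h.mem_of_rank_le hV.ge hzX hzV hxz hxX) hyV).trans hV.le).trans
      (le_max_left _ _)

theorem coloring_le_max {x y z : Below (succ κ)} (hz : x ≤ z ∨ y ≤ z) :
    h.coloring x y ≤ max (h.coloring x z) (h.coloring y z) := by
  rcases hz with hz | hz
  · exact h.coloring_le_max_of_le hz
  · rw [h.coloring_comm x y, max_comm]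
    exact h.coloring_le_max_of_le hz

/-- A member of limit rank is the directed union of the members below it. -/
theorem coloring_lt_of_isSuccLimit {X : μ} (hX : IsSuccLimit (rank h.wellFounded X))
    {α β : Below (succ κ)} (hα : α ∈ (X : Set (Below (succ κ))))
    (hβ : β ∈ (X : Set (Below (succ κ)))) : h.coloring α β < rank h.wellFounded X := by
  have hsub := h.neat X (by simpa using hX.ne_bot)
  have hd : IsDirectedFamily (restr μ X) := by
    rcases h.locallyAlmostDirected X with hd | ⟨X₁, X₂, hr, -, hcup⟩
    · exact hd
    exfalso
    have hX₁ : (X₁ : Set (Below (succ κ))) ∈ restr μ X := by rw [hcup]; simp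
    obtain ⟨Y, hY, hle⟩ := exists_le_rank_of_lt h.wellFounded
      (hX.succ_lt (rank_lt_rank h.wellFounded hX₁.2))
    have hle := Order.succ_le_iff.1 hle
    have : (Y : Set (Below (succ κ))) ∈ restr μ X := ⟨Y.2, hY⟩
    rw [hcup] at this
    rcases this with (hV | hV) | hV | hV
    · exact hle.not_ge (rank_le_rank h.wellFounded hV.2.subset)
    · exact hle.not_ge ((rank_le_rank h.wellFounded hV.2.subset).trans hr.ge)
    · exact hle.not_ge (rank_le_rank h.wellFounded hV.subset)
    · exact hle.not_ge
        ((rank_le_rank h.wellFounded (mem_singleton_iff.1 hV).subset).trans hr.ge)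
  have hα' := hα
  have hβ' := hβ
  rw [hsub] at hα' hβ'
  obtain ⟨V, hV, hαV⟩ := hα'
  obtain ⟨V', hV', hβV'⟩ := hβ'
  obtain ⟨U, hU, h1, h2⟩ := hd V hV V' hV'
  exact (h.coloring_le (X := ⟨U, hU.1⟩) (h1 hαV) (h2 hβV')).trans_lt
    (rank_lt_rank h.wellFounded hU.2)

/-- At a limit rank `ξ`, the part of the coloring at `β` that lies in the member of rank `ξ`
through `γ` is controlled by the coloring at `γ`. -/
theorem exists_lt_forall_coloring_le {X : μ} (hX : IsSuccLimit (rank h.wellFounded X))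
    {γ : Below (succ κ)} (hγ : γ ∈ (X : Set (Below (succ κ)))) {β : Below (succ κ)} (hβγ : β < γ) :
    ∃ η < rank h.wellFounded X,
      (h.coloring β γ ≤ rank h.wellFounded X → h.coloring β γ ≤ η) ∧
      ∀ α < β, h.coloring α γ ≤ rank h.wellFounded X → h.coloring α β ≤ rank h.wellFounded X →
        h.coloring α γ ≤ max (h.coloring α β) η := by
  obtain ⟨Y, hβY, hYX⟩ := h.exists_mem_rank_eq β le_rfl (X := X)
  obtain ⟨e, he⟩ := h.exists_orderIso hYX
  have hlt := h.coloring_lt_of_isSuccLimit hX (e ⟨β, hβY⟩).2 hγ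
  by_cases hβ : h.coloring β γ ≤ rank h.wellFounded X
  · refine ⟨h.coloring β γ, ?_, fun _ => le_rfl, fun α hα _ _ => ?_⟩
    · exact h.coloring_lt_of_isSuccLimit hX (h.mem_of_coloring_le hγ hβγ.le hβ) hγ
    · rw [h.coloring_comm β γ]
      exact h.coloring_le_max_of_le hα.le
  -- Here `β ∉ X`; its copy `e β` in `X` replaces it, and `η = m(e β, γ)`. Each relevant `α` lies in
  -- `X ∩ Y` and is fixed by `e`, so `m(α, e β) ≤ m(α, β)`.
  · refine ⟨_, hlt, fun h' => absurd h' hβ, fun α hα hαγ hαβ => ?_⟩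
    have hαX := h.mem_of_coloring_le hγ (hα.trans hβγ).le hαγ
    have hαY := h.mem_of_coloring_le hβY hα.le (hαβ.trans hYX.ge)
    have eα : (e ⟨α, hαY⟩ : Below (succ κ)) = α :=
      orderIso_apply_eq_self e α _ hαX fun δ hδ =>
        ⟨h.mem_of_rank_eq hYX hαY hαX hδ, h.mem_of_rank_eq hYX.symm hαX hαY hδ⟩
    have hlt' : α < e ⟨β, hβY⟩ := by
      conv_lhs => rw [← eα]
      exact e.strictMono (show (⟨α, hαY⟩ : (Y : Set (Below (succ κ)))) < ⟨β, hβY⟩ from hα)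
    obtain ⟨V, hVY, hβV, hV⟩ := h.exists_subset_rank_eq hβY (hαβ.trans hYX.ge)
    have hαV := h.mem_of_coloring_le hβV hα.le hV.ge
    obtain ⟨V', -, hV', hVr⟩ := he V hVY
    have hle : h.coloring α (e ⟨β, hβY⟩) ≤ h.coloring α β := by
      rw [← hV, ← hVr]
      refine h.coloring_le ?_ ?_
      · rw [hV', ← eα]
        exact mem_transport e _ hαV
      · rw [hV']
        exact mem_transport e _ hβV
    refine (h.coloring_le_max_of_le hlt'.le (y := γ)).trans ?_
    rw [h.coloring_comm γ]
    exact max_le_max_right _ hle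

end IsTwoCardinal

/-! ### Enumerations, fibers and pressing down in a regular cardinal. -/

section Unbounded

variable {κ : Cardinal.{u}}

/-- A strictly increasing enumeration, of length `κ`, of ordinals with the property `P`, such that
each term exceeds the values of `H` at the previous terms. -/
theorem exists_enum_of_unbounded (hκ : κ.IsRegular) {P : Ordinal.{u} → Prop}
    (hP : ∀ ζ < κ.ord, ∃ ξ, ζ < ξ ∧ ξ < κ.ord ∧ P ξ) {H : Ordinal.{u} → Ordinal.{u}}
    (hH : ∀ ξ < κ.ord, H ξ < κ.ord) :
    ∃ e : Ordinal.{u} → Ordinal.{u}, ∀ ξ < κ.ord, P (e ξ) ∧ e ξ < κ.ord ∧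
      ∀ ζ < ξ, H (e ζ) < e ξ := by
  classical
  let F : ∀ ξ : Ordinal.{u}, (∀ ζ < ξ, Ordinal.{u}) → Ordinal.{u} := fun ξ e =>
    -- By regularity, the default `0` is never taken at stages below `κ.ord`.
    if hx : ∃ x, P x ∧ x < κ.ord ∧ ∀ ζ (hζ : ζ < ξ), H (e ζ hζ) < x then hx.choose else 0
  let e : Ordinal.{u} → Ordinal.{u} := WellFounded.fix (wellFounded_lt (α := Ordinal.{u})) F
  have he : ∀ ξ, e ξ = F ξ fun ζ _ => e ζ := fun ξ => WellFounded.fix_eq _ _ _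
  refine ⟨e, fun ξ => ?_⟩
  induction ξ using WellFoundedLT.induction with
  | ind ξ ih =>
    intro hξ
    have hx : ∃ x, P x ∧ x < κ.ord ∧ ∀ ζ, ζ < ξ → H (e ζ) < x := by
      have hb : ⨆ i : ξ.ToType, H (e i.toOrd) < κ.ord := by
        refine Ordinal.iSup_lt_of_lt_cof ?_ fun i =>
          hH _ (ih _ i.toOrd.2 (i.toOrd.2.trans hξ)).2.1
        rw [hκ.cof_ord, mk_toType, ← lt_ord]
        exact hξ
      obtain ⟨x, hx, hxκ, hPx⟩ := hP _ hb
      refine ⟨x, hPx, hxκ, fun ζ hζ => lt_of_le_of_lt ?_ hx⟩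
      have := Ordinal.le_iSup (fun i : ξ.ToType => H (e i.toOrd)) (Ordinal.ToType.mk ⟨ζ, hζ⟩)
      simpa using this
    have heq : e ξ = hx.choose := by
      rw [he]
      exact dif_pos hx
    rw [heq]
    exact hx.choose_spec

theorem exists_unbounded_fiber (hκ : κ.IsRegular) {P : Ordinal.{u} → Prop}
    (hP : ∀ ζ < κ.ord, ∃ ξ, ζ < ξ ∧ ξ < κ.ord ∧ P ξ) {T : Type u} (hT : #T < κ)
    (f : Ordinal.{u} → T) :
    ∃ t, ∀ ζ < κ.ord, ∃ ξ, ζ < ξ ∧ ξ < κ.ord ∧ P ξ ∧ f ξ = t := by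
  by_contra! hc
  choose b hb hbf using hc
  obtain ⟨ξ, hξ, hξκ, hPξ⟩ := hP (⨆ t, b t)
    (Ordinal.iSup_lt_of_lt_cof (by rwa [hκ.cof_ord]) hb)
  exact hbf (f ξ) ξ ((Ordinal.le_iSup b (f ξ)).trans_lt hξ) hξκ hPξ rfl

/-- A pressing-down principle for functions that are regressive at the points of large
cofinality. -/
theorem exists_unbounded_le_of_regressive {lam : Cardinal.{u}} (hlam : lam.IsRegular)
    {g : Ordinal.{u} → Ordinal.{u}}
    (hg : ∀ ξ < (succ lam).ord, lam ≤ ξ.cof → g ξ < ξ) :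
    ∃ η < (succ lam).ord, ∀ ζ < (succ lam).ord, ∃ ξ, ζ < ξ ∧ ξ < (succ lam).ord ∧
      (lam ≤ ξ.cof ∧ g ξ ≤ η) := by
  have hκ := isRegular_succ hlam.aleph0_le
  have hlim : IsSuccLimit (succ lam).ord := isSuccLimit_ord hκ.aleph0_le
  by_contra! hc
  have hb : ∀ η, ∃ b, η < (succ lam).ord → b < (succ lam).ord ∧ ∀ ξ, b < ξ → ξ < (succ lam).ord →
      lam ≤ ξ.cof → η < g ξ := by
    intro η
    by_cases hη : η < (succ lam).ord
    · obtain ⟨b, hb⟩ := hc η hη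
      exact ⟨b, fun _ => hb⟩
    · exact ⟨0, fun h' => absurd h' hη⟩
  choose b hb using hb
  -- The first `lam` terms have a supremum of cofinality `lam`. There `g` falls below some term `e
  -- i`, although the supremum exceeds `b (e i)`, which forces `g` above `e i`.
  obtain ⟨e, he⟩ := exists_enum_of_unbounded hκ (P := fun _ => True)
    (fun ζ hζ => ⟨succ ζ, Order.lt_succ ζ, hlim.succ_lt hζ, trivial⟩)
    (H := fun ξ => max ξ (b ξ)) fun ξ hξ => max_lt hξ (hb ξ hξ).1
  have hlt : lam.ord < (succ lam).ord := ord_lt_ord.2 (Order.lt_succ lam)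
  have : NoMaxOrder lam.ord.ToType := Cardinal.noMaxOrder hlam.aleph0_le
  let f : lam.ord.ToType → Ordinal.{u} := fun i => e i.toOrd
  have hil : ∀ i : lam.ord.ToType, (i.toOrd : Ordinal) < (succ lam).ord := fun i =>
    i.toOrd.2.trans hlt
  have hmono : StrictMono f := fun i j hij =>
    (le_max_left _ _).trans_lt ((he _ (hil j)).2.2 _ (Ordinal.ToType.mk.symm.strictMono hij))
  have hcof : lam ≤ (⨆ i, f i).cof := by
    rw [Ordinal.cof_iSup hmono, Ordinal.cof_toType, hlam.cof_ord]
  have hsup : ⨆ i, f i < (succ lam).ord := by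
    refine Ordinal.iSup_lt_of_lt_cof ?_ fun i => (he _ (hil i)).2.1
    rw [hκ.cof_ord, mk_ord_toType]
    exact Order.lt_succ lam
  obtain ⟨i, hi⟩ := Ordinal.lt_iSup_iff.1 (hg _ hsup hcof)
  obtain ⟨j, hij⟩ := exists_gt i
  have hbj : b (f i) < f j := (le_max_right _ _).trans_lt
    ((he _ (hil j)).2.2 _ (Ordinal.ToType.mk.symm.strictMono hij))
  exact hi.not_gt ((hb (f i) (he _ (hil i)).2.1).2 _
    (hbj.trans_le (Ordinal.le_iSup f j)) hsup hcof)

end Unbounded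

/-! ### Bounds for and counting of small sets. -/

theorem exists_forall_lt_of_card_lt {c : Cardinal.{u}} (hc : c.IsRegular) {S : Set (Below c)}
    (hS : #S < c) : ∃ γ, ∀ x ∈ S, x < γ := by
  by_contra! hcon
  refine (Order.cof_le (s := S) fun x => ?_).not_gt ?_
  · exact hcon x
  · rwa [Ordinal.cof_toType, hc.cof_ord]

/-- Each such set is the range of a function on a proper initial segment of `lam`; there are `lam`
segments, each carrying at most `lam^{<lam} = lam` functions. -/
theorem mk_subsets_card_lt_le {lam : Cardinal.{u}} (hpow : lam ^< lam = lam)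
    {α : Type u} (hα : #α ≤ lam) : #{s : Set α // #s < lam} ≤ lam * lam := by
  let F : (Σ i : lam.ord.ToType, Iio i → α) → Set α := fun p => range p.2
  have hsub : {s : Set α | #s < lam} ⊆ range F := by
    intro s hs
    have hs' : (#s).ord < lam.ord := ord_lt_ord.2 hs
    obtain ⟨i, hi⟩ : ∃ i : lam.ord.ToType, (i.toOrd : Ordinal) = (#s).ord :=
      ⟨Ordinal.ToType.mk ⟨_, hs'⟩, by simp⟩
    have hcard : #(Iio i) = #s := by
      have hcard := congrArg Ordinal.card hi
      rw [card_ord] at hcard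
      exact (Ordinal.card_typein (r := fun x y : lam.ord.ToType => x < y) i).symm.trans hcard
    obtain ⟨φ⟩ := Cardinal.eq.1 hcard
    refine ⟨⟨_, fun x => (φ x : α)⟩, ?_⟩
    ext x
    simp only [F, mem_range]
    constructor
    · rintro ⟨y, rfl⟩
      exact (φ y).2
    · intro hx
      exact ⟨φ.symm ⟨x, hx⟩, by simp⟩
  refine (mk_le_mk_of_subset hsub).trans (mk_range_le.trans ?_)
  rw [mk_sigma]
  refine (Cardinal.sum_le_sum _ (fun _ => lam) fun i => ?_).trans ?_
  · rw [← power_def]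
    have hi : #(Iio i) < lam := by simpa using mk_Iio_lt i
    exact (power_le_power_right hα).trans ((le_powerlt _ hi).trans hpow.le)
  · simp

theorem DeltaRelations.symm {W : Type u} [LinearOrder W] {f : Sym2 W → Set W} {a a' : Set W}
    (hf : DeltaRelations f a a') : DeltaRelations f a' a := by
  intro τ hτ α hα β hβ
  obtain ⟨h1, h2, h3⟩ := hf τ hτ.symm β hβ α hα
  rw [Sym2.eq_swap (a := α)]
  exact ⟨fun hα hβ => h1 hβ hα, h3, h2⟩

/-! ### The function `f` and the reduction of the `Δ`-relations to colors. -/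

namespace IsTwoCardinal

variable {κ : Cardinal.{u}} {μ : Set (Set (Below (succ κ)))} (h : IsTwoCardinal κ μ)

include h

theorem rank_lt_ord (hκ : κ.IsRegular) (X : μ) : rank h.wellFounded X < κ.ord := by
  induction X using h.wellFounded.induction with
  | _ X ih =>
    rw [rank, Acc.rank_eq]
    refine Ordinal.iSup_lt_of_lt_cof ?_ fun Y =>
      (isSuccLimit_ord hκ.aleph0_le).succ_lt (ih Y.1 Y.2)
    rw [hκ.cof_ord]
    refine (mk_le_of_injective (f := fun Y : {Y : μ // properIncl μ Y X} =>
      (⟨Y.1, Y.1.2, Y.2⟩ : restr μ X)) fun Y Y' hY => ?_).trans_lt (h.locallySmall X X.2)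
    exact Subtype.ext (Subtype.ext (congrArg (fun Z : restr μ X => (Z : Set (Below (succ κ)))) hY))

theorem coloring_lt_ord (hκ : κ.IsRegular) (α β : Below (succ κ)) :
    h.coloring α β < κ.ord := by
  obtain ⟨X, -, -, hX⟩ := h.coloring_spec α β
  exact hX ▸ h.rank_lt_ord hκ X

theorem mk_coloring_le_lt {γ : Below (succ κ)} {X : μ} (hγ : γ ∈ (X : Set (Below (succ κ)))) :
    #{α | α < γ ∧ h.coloring α γ ≤ rank h.wellFounded X} < κ :=
  (mk_le_mk_of_subset fun _ hα => h.mem_of_coloring_le hγ hα.1.le hα.2).trans_lt (h.small X X.2)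

/-- All ranks below `κ` occur at the points with at least `κ` predecessors. -/
theorem exists_mem_rank_eq_of_le_mk (hκ : κ.IsRegular) {γ : Below (succ κ)} (hγ : κ ≤ #(Iio γ))
    {ξ : Ordinal.{u}} (hξ : ξ < κ.ord) :
    ∃ X : μ, γ ∈ (X : Set (Below (succ κ))) ∧ rank h.wellFounded X = ξ := by
  by_contra! hc
  have hlt : ∀ α, h.coloring α γ < ξ := by
    intro α
    obtain ⟨X, -, hγX, hX⟩ := h.coloring_spec α γ
    by_contra! hle
    obtain ⟨Y, -, hY, hr⟩ := h.exists_subset_rank_eq hγX (hle.trans hX.ge)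
    exact hc Y hY hr
  -- If all colors at `γ` were below `ξ`, the predecessors of `γ` would split into fewer than `κ`
  -- classes, each of size less than `κ`.
  have hsub : Iio γ ⊆ ⋃ i : ξ.ToType, {α | α < γ ∧ h.coloring α γ = i.toOrd} := by
    intro α hα
    refine mem_iUnion.2 ⟨Ordinal.ToType.mk ⟨_, hlt α⟩, hα, ?_⟩
    simp
  refine ((mk_le_mk_of_subset hsub).trans_lt ?_).not_ge hγ
  rw [card_iUnion_lt_iff_forall_of_isRegular hκ (by rwa [mk_toType, ← lt_ord])]
  intro i
  rcases eq_empty_or_nonempty {α | α < γ ∧ h.coloring α γ = i.toOrd} with he | ⟨α, -, hα⟩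
  · rw [he]
    simpa using hκ.pos
  · obtain ⟨X, -, hγX, hX⟩ := h.coloring_spec α γ
    refine (mk_le_mk_of_subset ?_).trans_lt (h.mk_coloring_le_lt hγX)
    exact fun β hβ => ⟨hβ.1, (hβ.2.trans (hα.symm.trans hX.symm)).le⟩

/-- The function `f(α, β) = μ_{m(α, β)}(α)`, for `α < β`, in terms of the coloring `m`. -/
noncomputable def deltaFunction (p : Sym2 (Below (succ κ))) : Set (Below (succ κ)) :=
  {x | ∀ y ∈ p, x < y ∧ h.coloring x y ≤ Sym2.lift ⟨h.coloring, h.coloring_comm⟩ p}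

theorem mem_deltaFunction {α β x : Below (succ κ)} :
    x ∈ h.deltaFunction s(α, β) ↔ (x < α ∧ h.coloring x α ≤ h.coloring α β) ∧
      (x < β ∧ h.coloring x β ≤ h.coloring α β) := by
  simp [deltaFunction]

theorem deltaFunction_eq_of_lt {α β : Below (succ κ)} (hαβ : α < β) {X : μ}
    (hα : α ∈ (X : Set (Below (succ κ)))) (hX : rank h.wellFounded X = h.coloring α β) :
    h.deltaFunction s(α, β) = (X : Set (Below (succ κ))) ∩ Iio α := by
  ext x
  rw [mem_deltaFunction]
  constructor
  · rintro ⟨⟨hx, hm⟩, -⟩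
    exact ⟨h.mem_of_coloring_le hα hx.le (hm.trans hX.ge), hx⟩
  · rintro ⟨hx, hxα⟩
    have hm : h.coloring x α ≤ h.coloring α β := hX ▸ h.coloring_le hx hα
    refine ⟨⟨hxα, hm⟩, lt_trans hxα hαβ, (h.coloring_le_max_of_le (le_of_lt hxα)).trans ?_⟩
    exact max_le hm (h.coloring_comm β α).le

theorem isTerm_deltaFunction {α β : Below (succ κ)} (hαβ : α < β) :
    h.IsTerm (h.coloring α β) α (h.deltaFunction s(α, β)) := by
  obtain ⟨X, hα, -, hX⟩ := h.coloring_spec α β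
  exact ⟨X, hX, hα, h.deltaFunction_eq_of_lt hαβ hα hX⟩

theorem mk_deltaFunction_lt {p : Sym2 (Below (succ κ))} (hp : ¬ p.IsDiag) :
    #(h.deltaFunction p) < κ := by
  induction p using Sym2.ind with
  | _ α β =>
    wlog hαβ : α < β generalizing α β
    · rw [Sym2.eq_swap] at hp ⊢
      exact this β α hp (lt_of_le_of_ne (not_lt.1 hαβ) (by simpa using hp))
    obtain ⟨X, -, -, hX⟩ := h.isTerm_deltaFunction hαβ
    rw [hX]
    exact (mk_le_mk_of_subset inter_subset_left).trans_lt (h.small X X.2)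

/-- One-sided information suffices: when `τ < α`, the ultrametric inequality through `α` also yields
`m(β, τ) ≤ m(α, β)`. -/
theorem deltaRelations_of_coloring_le {a a' : Set (Below (succ κ))}
    (hm : ∀ τ ∈ a ∩ a', ∀ α ∈ a \ a', ∀ β ∈ a' \ a, h.coloring α τ ≤ h.coloring α β) :
    DeltaRelations h.deltaFunction a a' := by
  intro τ hτ α hα β hβ
  have h1 := hm τ hτ α hα β hβ
  have h2 : τ < α → h.coloring β τ ≤ h.coloring α β := fun hlt =>
    (h.coloring_le_max (Or.inr hlt.le)).trans
      (max_le (h.coloring_comm β α).le ((h.coloring_comm τ α).trans_le h1))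
  refine ⟨fun hτα hτβ => ?_, fun hτβ x hx => ?_, fun hτα x hx => ?_⟩
  · rw [mem_deltaFunction, h.coloring_comm τ, h.coloring_comm τ]
    exact ⟨⟨hτα, h1⟩, hτβ, h2 hτα⟩
  · rw [mem_deltaFunction] at hx ⊢
    have hxα := hx.1.2.trans h1
    exact ⟨⟨hx.1.1, hxα⟩, hx.2.1.trans hτβ, (h.coloring_le_max_of_le hx.1.1.le).trans
      (max_le hxα (h.coloring_comm β α).le)⟩
  · rw [mem_deltaFunction] at hx ⊢
    have hxβ := hx.1.2.trans (h2 hτα)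
    exact ⟨⟨hx.2.1.trans hτα, (h.coloring_le_max_of_le hx.1.1.le).trans (max_le hxβ le_rfl)⟩,
      hx.1.1, hxβ⟩

/-- Relative to `γ`, root points have color at most `η`, `α` has color in `(η, ξ]` and `β` has color
above `ξ`. So `m(α, τ) ≤ m(α, γ)`, and a smaller `m(α, β)` would pull the color of `α` down to `η`
(if `α < β`) or that of `β` down to `ξ` (if `β ≤ α`). -/
theorem coloring_le_coloring_of_root {γ : Below (succ κ)} {ξ η : Ordinal.{u}}
    {a a' : Set (Below (succ κ))} (ha : ∀ α ∈ a, α < γ ∧ h.coloring α γ ≤ ξ)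
    (ha' : ∀ β ∈ a', β < γ ∧ (h.coloring β γ ≤ ξ → h.coloring β γ ≤ η) ∧
      ∀ α < β, h.coloring α γ ≤ ξ → h.coloring α β ≤ ξ →
        h.coloring α γ ≤ max (h.coloring α β) η)
    (hroot : ∀ x, h.coloring x γ ≤ η → (x ∈ a ↔ x ∈ a'))
    {τ α β : Below (succ κ)} (hτ : τ ∈ a ∩ a') (hα : α ∈ a \ a') (hβ : β ∈ a' \ a) :
    h.coloring α τ ≤ h.coloring α β := by
  have hαη : η < h.coloring α γ := lt_of_not_ge fun hle => hα.2 ((hroot α hle).1 hα.1)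
  have hτη : h.coloring τ γ ≤ η := (ha' τ hτ.2).2.1 (ha τ hτ.1).2
  have hατ : h.coloring α τ ≤ h.coloring α γ :=
    (h.coloring_le_max_of_le (ha α hα.1).1.le).trans (max_le le_rfl (hτη.trans hαη.le))
  have hβξ : ξ < h.coloring β γ := lt_of_not_ge fun hle =>
    hβ.2 ((hroot β ((ha' β hβ.1).2.1 hle)).2 hβ.1)
  refine le_of_not_gt fun hlt => ?_
  have hαβ : h.coloring α β ≤ ξ := hlt.le.trans (hατ.trans (ha α hα.1).2)
  rcases lt_or_ge α β with hlt' | hge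
  · have := (ha' β hβ.1).2.2 α hlt' (ha α hα.1).2 hαβ
    rcases le_max_iff.1 this with hle | hle
    · exact hlt.not_ge (hατ.trans hle)
    · exact hαη.not_ge hle
  · have := h.coloring_le_max_of_le hge (y := γ)
    rw [h.coloring_comm β α, h.coloring_comm γ α] at this
    exact hβξ.not_ge (this.trans (max_le hαβ (ha α hα.1).2))

end IsTwoCardinal

/-! ### Thinning out the given family. -/

theorem collectionwisePropertyDelta_deltaFunction {lam : Cardinal.{u}} (hlam : lam.IsRegular)
    (hpow : lam ^< lam = lam) {μ : Set (Set (Below (succ (succ lam))))}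
    (h : IsTwoCardinal (succ lam) μ) : CollectionwisePropertyDelta lam h.deltaFunction := by
  intro a₀ ha₀
  have hκ := isRegular_succ hlam.aleph0_le
  have hκ' := isRegular_succ hκ.aleph0_le
  classical
  let a : Ordinal.{u} → Set (Below (succ (succ lam))) := fun ξ =>
    if hξ : ξ < (succ lam).ord then a₀ (Ordinal.ToType.mk ⟨ξ, hξ⟩) else ∅
  have ha_eq : ∀ {ξ} (hξ : ξ < (succ lam).ord), a ξ = a₀ (Ordinal.ToType.mk ⟨ξ, hξ⟩) :=
    fun hξ => dif_pos hξ
  have ha : ∀ ξ, #(a ξ) < lam := by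
    intro ξ
    by_cases hξ : ξ < (succ lam).ord
    · exact ha_eq hξ ▸ ha₀ _
    · simpa only [a, dif_neg hξ, mk_eq_zero] using hlam.pos
  obtain ⟨γ, hγa, hγ⟩ : ∃ γ, (∀ ξ, ∀ α ∈ a ξ, α < γ) ∧ succ lam ≤ #(Iio γ) := by
    -- Bounding an auxiliary set `S` of size `lam⁺` too gives `γ` enough predecessors for all ranks
    -- below `lam⁺` to occur at `γ`.
    obtain ⟨S, hS⟩ := le_mk_iff_exists_set.1
      ((Order.le_succ (succ lam)).trans (mk_ord_toType (succ (succ lam))).ge)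
    obtain ⟨γ, hγ⟩ := exists_forall_lt_of_card_lt hκ' (S := (⋃ i, a₀ i) ∪ S) <| by
      refine (mk_union_le _ _).trans_lt (add_lt_of_lt hκ'.aleph0_le ?_ ?_)
      · rw [card_iUnion_lt_iff_forall_of_isRegular hκ' (by
          rw [mk_ord_toType]; exact Order.lt_succ _)]
        exact fun i => (ha₀ i).trans ((Order.lt_succ _).trans (Order.lt_succ _))
      · rw [hS]
        exact Order.lt_succ _
    refine ⟨γ, fun ξ α hα => ?_,
      hS.ge.trans (mk_le_mk_of_subset fun x hx => hγ x (Or.inr hx))⟩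
    by_cases hξ : ξ < (succ lam).ord
    · rw [ha_eq hξ] at hα
      exact hγ α (Or.inl (mem_iUnion.2 ⟨_, hα⟩))
    · simp only [a, dif_neg hξ, mem_empty_iff_false] at hα
  let Q : Ordinal.{u} → Ordinal.{u} → Below (succ (succ lam)) → Prop := fun η ξ β =>
    (h.coloring β γ ≤ ξ → h.coloring β γ ≤ η) ∧
      ∀ α < β, h.coloring α γ ≤ ξ → h.coloring α β ≤ ξ →
        h.coloring α γ ≤ max (h.coloring α β) η
  have hQ : ∀ {η η' ξ β}, η ≤ η' → Q η ξ β → Q η' ξ β := fun hle hq =>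
    ⟨fun hξ => (hq.1 hξ).trans hle, fun α hα h1 h2 =>
      (hq.2 α hα h1 h2).trans (max_le_max_left _ hle)⟩
  have hg : ∀ ξ, ∃ η, ξ < (succ lam).ord → lam ≤ ξ.cof → η < ξ ∧ ∀ β ∈ a ξ, Q η ξ β := by
    intro ξ
    by_cases hξ : ξ < (succ lam).ord ∧ lam ≤ ξ.cof
    · have hlim : IsSuccLimit ξ := Ordinal.one_lt_cof_iff.1
        (one_lt_aleph0.trans_le (hlam.aleph0_le.trans hξ.2))
      obtain ⟨X, hγX, rfl⟩ := h.exists_mem_rank_eq_of_le_mk hκ hγ hξ.1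
      choose b hb hbQ using fun β : a (rank h.wellFounded X) =>
        h.exists_lt_forall_coloring_le hlim hγX (hγa _ β β.2)
      refine ⟨⨆ β, b β, fun _ _ => ⟨?_, fun β hβ => ?_⟩⟩
      · exact Ordinal.iSup_lt_of_lt_cof ((ha _).trans_le hξ.2) hb
      · exact hQ (Ordinal.le_iSup b ⟨β, hβ⟩) (hbQ ⟨β, hβ⟩)
    · exact ⟨0, fun h1 h2 => absurd ⟨h1, h2⟩ hξ⟩
  choose g hg using hg
  obtain ⟨η, hη, hunb⟩ := exists_unbounded_le_of_regressive hlam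
    (g := g) fun ξ h1 h2 => (hg ξ h1 h2).1
  let F : Set (Below (succ (succ lam))) := {α | α < γ ∧ h.coloring α γ ≤ η}
  have hF : #F ≤ lam := by
    obtain ⟨X, hγX, hX⟩ := h.exists_mem_rank_eq_of_le_mk hκ hγ hη
    have := h.mk_coloring_le_lt hγX
    rw [hX] at this
    exact Order.lt_succ_iff.1 this
  obtain ⟨D, hD⟩ := exists_unbounded_fiber hκ hunb (T := {s : Set F // #s < lam})
    ((mk_subsets_card_lt_le hpow hF).trans_lt <| by
      rw [mul_eq_self hlam.aleph0_le]
      exact Order.lt_succ lam)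
    fun ξ => ⟨Subtype.val ⁻¹' a ξ,
      (mk_preimage_of_injective _ _ Subtype.val_injective).trans_lt (ha ξ)⟩
  -- The first entry makes the enumeration strictly increasing; the second puts the colors with `γ`
  -- of each earlier set below every later index.
  let H : Ordinal.{u} → Ordinal.{u} := fun ξ => max ξ (⨆ α : a ξ, h.coloring α γ)
  have hH : ∀ ξ < (succ lam).ord, H ξ < (succ lam).ord := by
    refine fun ξ hξ => max_lt hξ (Ordinal.iSup_lt_of_lt_cof ?_ fun α => h.coloring_lt_ord hκ _ _)
    rw [hκ.cof_ord]
    exact (ha ξ).trans (Order.lt_succ lam)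
  obtain ⟨e, he⟩ := exists_enum_of_unbounded hκ hD hH
  have hmain : ∀ ξ < (succ lam).ord, ∀ ζ < ξ,
      DeltaRelations h.deltaFunction (a (e ζ)) (a (e ξ)) := by
    intro ξ hξ ζ hζ
    obtain ⟨⟨⟨hcof, hge⟩, hDξ⟩, hlt, hH'⟩ := he ξ hξ
    have hDζ := (he ζ (hζ.trans hξ)).1.2
    refine h.deltaRelations_of_coloring_le fun τ hτ α hα β hβ =>
      h.coloring_le_coloring_of_root (γ := γ) (ξ := e ξ) (η := η) (fun α hα => ⟨hγa _ α hα, ?_⟩)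
        (fun β hβ => ⟨hγa _ β hβ, hQ hge ((hg _ hlt hcof).2 β hβ)⟩) (fun x hx => ?_) hτ hα hβ
    · exact (Ordinal.le_iSup (fun α : a (e ζ) => h.coloring α γ) ⟨α, hα⟩).trans
        ((le_max_right _ _).trans (hH' ζ hζ).le)
    · by_cases hxγ : x < γ
      · have := congrArg Subtype.val (hDζ.trans hDξ.symm)
        exact Set.ext_iff.1 this ⟨x, hxγ, hx⟩
      · exact ⟨fun h' => absurd (hγa _ x h') hxγ, fun h' => absurd (hγa _ x h') hxγ⟩
  let E : Below (succ lam) → Below (succ lam) := fun i =>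
    Ordinal.ToType.mk ⟨e i.toOrd, (he _ i.toOrd.2).2.1⟩
  have hEa : ∀ i, a₀ (E i) = a (e i.toOrd) := fun i =>
    (ha_eq (he _ i.toOrd.2).2.1).symm
  have hEmono : StrictMono E := fun i j hij => by
    refine Ordinal.ToType.mk.strictMono (show e i.toOrd < e j.toOrd from ?_)
    exact (le_max_left _ _).trans_lt
      ((he _ j.toOrd.2).2.2 _ (Ordinal.ToType.mk.symm.strictMono hij))
  refine ⟨range E, ?_, ?_⟩
  · rw [mk_range_eq _ hEmono.injective, mk_ord_toType]
  · rintro _ ⟨i, rfl⟩ _ ⟨j, rfl⟩ hne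
    rw [hEa, hEa]
    rcases lt_trichotomy i j with hij | rfl | hij
    · exact hmain _ j.toOrd.2 _ (Ordinal.ToType.mk.symm.strictMono hij)
    · exact absurd rfl hne
    · exact DeltaRelations.symm (hmain _ i.toOrd.2 _ (Ordinal.ToType.mk.symm.strictMono hij))

end TwoCardinal

theorem mainTheorem1 (lam : Cardinal.{u}) (hreg : lam.IsRegular) (hpow : lam ^< lam = lam)
    (μ : Set (Set (TwoCardinal.Below (succ (succ lam)))))
    (hμ : TwoCardinal.IsTwoCardinal (succ lam) μ) :
    ∃ f : Sym2 (TwoCardinal.Below (succ (succ lam))) →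
        Set (TwoCardinal.Below (succ (succ lam))),
      (∀ p, ¬ p.IsDiag → #(f p) ≤ lam) ∧
      (∀ α β, α < β → hμ.IsTerm (hμ.coloring α β) α (f s(α, β))) ∧
      TwoCardinal.CollectionwisePropertyDelta lam f :=
  ⟨hμ.deltaFunction, fun _ hp => Order.lt_succ_iff.1 (hμ.mk_deltaFunction_lt hp),
    fun _ _ hαβ => hμ.isTerm_deltaFunction hαβ,
    TwoCardinal.collectionwisePropertyDelta_deltaFunction hreg hpow hμ⟩
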